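/- Let $K$ be a field of characteristic $p>0$, let $r\ge 0$, and let $f=\sum_{k\in\mathbb{N}^r}a_k x^k$ be a formal power series in $K[[x_1,\dots,x_r]]$ which is algebraic over the field of rational functions $K(x_1,\dots,x_r)$ (as an element of the fraction field of $K[[x_1,\dots,x_r]]$). Then for every multi-index $n\in\mathbb{N}^r$ with $n\neq 0$, the power series $$h(X):=\sum_{k\ge 0}a_{p^k n}X^{p^k}\in K[[X]]$$ is algebraic over the field of rational functions $K(X)$. -/

import Mathlib

noncomputable section

instance instIsDomainMvPowerSeriesField (σ K : Type*) [Field K] : IsDomain (MvPowerSeries σ K) :=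
  NoZeroDivisors.to_isDomain _

/-- The embedding `K(x) → Frac K⟦x⟧` of the field of rational functions in the variables `x_i`
(`i ∈ σ`) into the fraction field of the ring of formal power series, induced by the inclusion
of the polynomial ring into the power series ring. -/
def ratFuncToFracPowerSeries (σ K : Type*) [Field K] :
    FractionRing (MvPolynomial σ K) →+* FractionRing (MvPowerSeries σ K) :=
  IsFractionRing.map (A := MvPolynomial σ K) (B := MvPowerSeries σ K)
    (j := MvPolynomial.coeToMvPowerSeries.ringHom)
    (MvPolynomial.coe_injective σ K)

/-- A formal power series `f ∈ K⟦x⟧` is algebraic over the field of rational functions `K(x)`: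
its image in `Frac K⟦x⟧` is algebraic over the subfield `K(x)`. -/
def MvPowerSeries.IsAlgebraicOverRatFunc {σ K : Type*} [Field K] (f : MvPowerSeries σ K) : Prop :=
  letI : Algebra (FractionRing (MvPolynomial σ K)) (FractionRing (MvPowerSeries σ K)) :=
    (ratFuncToFracPowerSeries σ K).toAlgebra
  IsAlgebraic (FractionRing (MvPolynomial σ K))
    (algebraMap (MvPowerSeries σ K) (FractionRing (MvPowerSeries σ K)) f)

open scoped RatFunc in
/-- A one-variable formal power series `h ∈ K⟦X⟧` is algebraic over the field of rational functions
`K(X)`: its image in the field `K⸨X⸩ = Frac K⟦X⟧` of Laurent series is algebraic over `K(X)`. -/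
def PowerSeries.IsAlgebraicOverRatFunc {K : Type*} [Field K] (h : PowerSeries K) : Prop :=
  IsAlgebraic (RatFunc K) (algebraMap (PowerSeries K) (LaurentSeries K) h)

open Classical in
/-- For `f = ∑ a_k x^k` and an exponent `n`, the one-variable series
`∑_{k ≥ 0} a_{p^k n} X^{p^k}`: the coefficient of `X^m` is `a_{m n}` if `m` is of the form `p^k`
with `k ≥ 0`, and `0` otherwise. -/
def frobeniusRaySeries {σ K : Type*} [Field K] (p : ℕ) (f : MvPowerSeries σ K) (n : σ →₀ ℕ) :
    PowerSeries K :=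
  PowerSeries.mk fun m => if ∃ k : ℕ, m = p ^ k then MvPowerSeries.coeff (m • n) f else 0

end

theorem coeff_pow_frobeniusRaySeries {σ K : Type*} [Field K] (p : ℕ) (f : MvPowerSeries σ K)
    (n : σ →₀ ℕ) (k : ℕ) :
    PowerSeries.coeff (p ^ k) (frobeniusRaySeries p f n) = MvPowerSeries.coeff (p ^ k • n) f := by
  simp [frobeniusRaySeries]

theorem coeff_frobeniusRaySeries_of_ne {σ K : Type*} [Field K] (p : ℕ) (f : MvPowerSeries σ K)
    (n : σ →₀ ℕ) (m : ℕ) (hm : ∀ k : ℕ, m ≠ p ^ k) :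
    PowerSeries.coeff m (frobeniusRaySeries p f n) = 0 := by
  simp [frobeniusRaySeries, hm]

/-! The powers `f ^ p ^ i` span a finite-dimensional space over the rational functions, so they
satisfy a nontrivial relation with polynomial coefficients. Over an algebraic closure `L` of `K`,
the Cartier operator Λ extracts the coefficients at exponents divisible by `p` and takes their
`p`-th roots. The relation traps all Λ^i f, up to one common polynomial factor, in a
finite-dimensional `L`-space (`exists_finite_forall_mul_cartier_iterate_mem`), so they are linearly
dependent over `L`.

Reading a dependence at the exponents `p ^ j • n` and clearing `p`-power roots gives a recurrence
for `b k = coeff (p ^ k • n) f`, which a linear functional `L → K` brings down to `K`. Frobenius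
shifts the series `∑ b_k X^{p^k}`, so the recurrence says that a combination of its `p`-power powers
is a polynomial (`sum_smul_lacunary_pow`). This is an algebraic equation. -/

/-! ### Additive-type relations with polynomial coefficients -/

/-- Independence over `A` would give independence over `F` by clearing denominators, for an infinite
family inside the finite-dimensional `F[x]`. -/
theorem IsAlgebraic.exists_finsupp_sum_smul_pow_eq_zero (A : Type*) {F E : Type*} [CommRing A]
    [Field F] [Field E] [Algebra A F] [IsFractionRing A F] [Algebra F E] [Algebra A E]
    [IsScalarTower A F E] {x : E} (hx : IsAlgebraic F x) (e : ℕ → ℕ) :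
    ∃ c : ℕ →₀ A, c ≠ 0 ∧ (c.sum fun i a => a • x ^ e i) = 0 := by
  by_contra! h
  have hli : LinearIndependent A fun i => x ^ e i := by
    rw [linearIndependent_iff]
    intro c hc
    by_contra h0
    exact h c h0 (by simpa [Finsupp.linearCombination_apply] using hc)
  rw [LinearIndependent.iff_fractionRing A F] at hli
  have hfin : Module.Finite F (Algebra.adjoin F {x}) :=
    Module.Finite.iff_fg.mpr hx.isIntegral.fg_adjoin_singleton
  have hli' : LinearIndependent F (fun i : ℕ =>
      (⟨x ^ e i, pow_mem (Algebra.self_mem_adjoin_singleton F x) _⟩ : Algebra.adjoin F {x})) :=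
    LinearIndependent.of_comp (Algebra.adjoin F {x}).val.toLinearMap hli
  exact not_finite_iff_infinite.mpr inferInstance hli'.finite

theorem MvPowerSeries.IsAlgebraicOverRatFunc.exists_finsupp_sum_coe_mul_pow_eq_zero
    {σ K : Type*} [Field K] {f : MvPowerSeries σ K} (hf : f.IsAlgebraicOverRatFunc) (e : ℕ → ℕ) :
    ∃ c : ℕ →₀ MvPolynomial σ K, c ≠ 0 ∧
      (c.sum fun i a => (a : MvPowerSeries σ K) * f ^ e i) = 0 := by
  let _ : Algebra (FractionRing (MvPolynomial σ K)) (FractionRing (MvPowerSeries σ K)) :=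
    (ratFuncToFracPowerSeries σ K).toAlgebra
  have : IsScalarTower (MvPolynomial σ K) (FractionRing (MvPolynomial σ K))
      (FractionRing (MvPowerSeries σ K)) := by
    refine IsScalarTower.of_algebraMap_eq (R := MvPolynomial σ K)
      (S := FractionRing (MvPolynomial σ K)) (A := FractionRing (MvPowerSeries σ K)) fun a => ?_
    change _ = ratFuncToFracPowerSeries σ K (algebraMap _ _ a)
    unfold ratFuncToFracPowerSeries IsFractionRing.map
    rw [IsLocalization.map_eq]
    rfl
  obtain ⟨c, hc0, hc⟩ := IsAlgebraic.exists_finsupp_sum_smul_pow_eq_zero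
    (MvPolynomial σ K) (F := FractionRing (MvPolynomial σ K)) hf e
  refine ⟨c, hc0, IsFractionRing.injective _ (FractionRing (MvPowerSeries σ K)) ?_⟩
  rw [map_zero, ← hc, Finsupp.sum, Finsupp.sum, map_sum]
  refine Finset.sum_congr rfl fun i _ => ?_
  rw [map_mul, map_pow, Algebra.smul_def]
  rfl

/-! ### Series of bounded degree and the Cartier operator -/

namespace MvPowerSeries

variable {σ L : Type*}

section BoundedDegree

/-- Power series all of whose monomials have total degree at most `N`. -/
def degreeLE (σ L : Type*) [CommSemiring L] (N : ℕ) : Submodule L (MvPowerSeries σ L) where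
  carrier := {f | ∀ k : σ →₀ ℕ, N < k.degree → coeff k f = 0}
  add_mem' hf hg k hk := by rw [map_add, hf k hk, hg k hk, add_zero]
  zero_mem' _ _ := map_zero _
  smul_mem' c f hf k hk := by rw [map_smul, hf k hk, smul_zero]

theorem degreeLE_mono [CommSemiring L] {M N : ℕ} (h : M ≤ N) :
    degreeLE σ L M ≤ degreeLE σ L N := fun _ hf k hk => hf k (h.trans_lt hk)

theorem mul_mem_degreeLE [CommSemiring L] {M N : ℕ} {f g : MvPowerSeries σ L}
    (hf : f ∈ degreeLE σ L M) (hg : g ∈ degreeLE σ L N) : f * g ∈ degreeLE σ L (M + N) := by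
  classical
  intro k hk
  rw [coeff_mul]
  refine Finset.sum_eq_zero fun ab hab => ?_
  rw [Finset.HasAntidiagonal.mem_antidiagonal] at hab
  rw [← hab, map_add] at hk
  rcases lt_or_ge M ab.1.degree with h | h
  · rw [hf _ h, zero_mul]
  · rw [hg _ (by lia), mul_zero]

theorem one_mem_degreeLE [CommSemiring L] : (1 : MvPowerSeries σ L) ∈ degreeLE σ L 0 := by
  classical
  intro k hk
  rw [coeff_one, if_neg]
  rintro rfl
  simp at hk

theorem pow_mem_degreeLE [CommSemiring L] {M : ℕ} {f : MvPowerSeries σ L}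
    (hf : f ∈ degreeLE σ L M) (n : ℕ) : f ^ n ∈ degreeLE σ L (n * M) := by
  induction n with
  | zero => simpa using one_mem_degreeLE
  | succ n ih => rw [pow_succ, Nat.succ_mul]; exact mul_mem_degreeLE ih hf

theorem coe_mem_degreeLE [CommSemiring L] (P : MvPolynomial σ L) :
    (P : MvPowerSeries σ L) ∈ degreeLE σ L P.totalDegree := by
  intro k hk
  rw [MvPolynomial.coeff_coe]
  exact MvPolynomial.coeff_eq_zero_of_totalDegree_lt hk

instance finite_degreeLE [Finite σ] [Field L] (N : ℕ) : Module.Finite L (degreeLE σ L N) := by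
  have : Finite {k : σ →₀ ℕ | k.degree ≤ N} := Finsupp.finite_of_degree_le N
  let T : degreeLE σ L N →ₗ[L] ({k : σ →₀ ℕ | k.degree ≤ N} → L) :=
    LinearMap.pi fun k => (coeff k.1).comp (degreeLE σ L N).subtype
  refine Module.Finite.of_injective T fun f g hfg => Subtype.ext (MvPowerSeries.ext fun k => ?_)
  rcases lt_or_ge N k.degree with h | h
  · rw [f.2 k h, g.2 k h]
  · exact congrFun hfg ⟨k, h⟩

end BoundedDegree

section Cartier

variable [Field L] (p : ℕ) [Fact p.Prime] [CharP L p]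

theorem coeff_smul_pow_char (g : MvPowerSeries σ L) (k : σ →₀ ℕ) :
    coeff (p • k) (g ^ p) = coeff k g ^ p := by
  rw [← map_frobenius_expand p (NeZero.ne p), coeff_map, coeff_expand_smul, frobenius_def]

variable [PerfectRing L p]

/-- The Cartier operator `∑ a_k x^k ↦ ∑ a_{p k}^{1/p} x^k`. -/
noncomputable def cartier : MvPowerSeries σ L →+ MvPowerSeries σ L where
  toFun f k := (frobeniusEquiv L p).symm (coeff (p • k) f)
  map_zero' := funext fun k => by
    rw [map_zero, map_zero]
    rfl
  map_add' f g := funext fun k => by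
    rw [map_add, map_add]
    rfl

theorem coeff_cartier (f : MvPowerSeries σ L) (k : σ →₀ ℕ) :
    coeff k (cartier p f) = (frobeniusEquiv L p).symm (coeff (p • k) f) := rfl

theorem coeff_cartier_pow (f : MvPowerSeries σ L) (k : σ →₀ ℕ) :
    coeff k (cartier p f) ^ p = coeff (p • k) f := by
  rw [coeff_cartier, frobeniusEquiv_symm_pow_p]

theorem coeff_cartier_iterate_pow (f : MvPowerSeries σ L) (j : ℕ) (k : σ →₀ ℕ) :
    coeff k ((cartier p)^[j] f) ^ p ^ j = coeff (p ^ j • k) f := by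
  induction j generalizing k with
  | zero => simp
  | succ j ih =>
    rw [Function.iterate_succ_apply', pow_succ', pow_mul, coeff_cartier_pow, ih, smul_smul,
      ← pow_succ, ← pow_succ']

/-- Only exponents divisible by `p` occur in `g ^ p`, so at exponent `p • k` only pairs `(p • a, p •
b)` contribute. -/
theorem cartier_pow_mul (g u : MvPowerSeries σ L) : cartier p (g ^ p * u) = g * cartier p u := by
  classical
  ext k
  apply (frobeniusEquiv L p).injective
  rw [frobeniusEquiv_def, coeff_cartier_pow, coeff_mul, coeff_mul, map_sum]
  have hp : p ≠ 0 := NeZero.ne p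
  symm
  refine Finset.sum_of_injOn (fun ab => (p • ab.1, p • ab.2)) ?_ ?_ ?_ ?_
  · rintro ⟨a, b⟩ - ⟨c, d⟩ - h
    simpa [hp] using h
  · rintro ⟨a, b⟩ h
    simp only [Finset.mem_coe, Finset.HasAntidiagonal.mem_antidiagonal] at h ⊢
    rw [← smul_add, h]
  · rintro ⟨a, b⟩ h hn
    rw [Finset.HasAntidiagonal.mem_antidiagonal] at h
    have : ∃ i, ¬ p ∣ a i := by
      by_contra! hd
      choose a' ha' using hd
      have hb : ∀ i, p ∣ b i := fun i => by
        have := DFunLike.congr_fun h i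
        simp only [Finsupp.add_apply, Finsupp.smul_apply, smul_eq_mul] at this
        exact (Nat.dvd_add_right ⟨a' i, ha' i⟩).mp ⟨k i, this⟩
      refine hn ⟨(a.mapRange (· / p) (by simp), b.mapRange (· / p) (by simp)), ?_, ?_⟩
      · simp only [Finset.mem_coe, Finset.HasAntidiagonal.mem_antidiagonal]
        ext i
        have := DFunLike.congr_fun h i
        simp only [Finsupp.add_apply, Finsupp.smul_apply, smul_eq_mul,
          Finsupp.mapRange_apply] at this ⊢
        rw [← Nat.add_div_of_dvd_right ⟨a' i, ha' i⟩, this, Nat.mul_div_cancel_left _ (by lia)]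
      · ext i
        · simp [Nat.mul_div_cancel' ⟨a' i, ha' i⟩]
        · simp [Nat.mul_div_cancel' (hb i)]
    obtain ⟨i, hi⟩ := this
    dsimp only
    rw [← map_frobenius_expand p hp, coeff_map, coeff_expand_of_not_dvd p hp g hi, map_zero,
      zero_mul]
  · rintro ⟨a, b⟩ -
    dsimp only
    rw [frobeniusEquiv_def, mul_pow, coeff_cartier_pow, coeff_smul_pow_char]

theorem cartier_iterate_pow (g : MvPowerSeries σ L) (j : ℕ) :
    (cartier p)^[j] (g ^ p ^ j) = g := by
  have h1 : ∀ g : MvPowerSeries σ L, cartier p (g ^ p) = g := fun g => by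
    ext k
    rw [coeff_cartier, coeff_smul_pow_char, frobeniusEquiv_symm_pow]
  induction j with
  | zero => simp
  | succ j ih => rw [Function.iterate_succ_apply, pow_succ, pow_mul, h1, ih]

theorem cartier_mem_degreeLE {N M : ℕ} (h : N < p * (M + 1)) {f : MvPowerSeries σ L}
    (hf : f ∈ degreeLE σ L N) : cartier p f ∈ degreeLE σ L M := by
  intro k hk
  rw [coeff_cartier, hf, map_zero]
  rw [map_nsmul, smul_eq_mul]
  exact h.trans_le (Nat.mul_le_mul_left p hk)

/-- If `∑ A_i F^{p^i} = 0` with polynomials `A_i` and `A_0 ≠ 0`, the iterates of the Cartier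
operator on `F`, multiplied by a fixed power of `A_0`, stay in a finite-dimensional space. -/
theorem exists_finite_forall_mul_cartier_iterate_mem [Finite σ] {d M : ℕ}
    {A : ℕ → MvPowerSeries σ L} (hA : ∀ i, A i ∈ degreeLE σ L M) {F : MvPowerSeries σ L}
    (hF : ∑ i ∈ Finset.range (d + 1), A i * F ^ p ^ i = 0) :
    ∃ W : Submodule L (MvPowerSeries σ L), Module.Finite L W ∧
      ∀ j, A 0 ^ p ^ d * (cartier p)^[j] F ∈ W := by
  have hp2 : 2 ≤ p := (Fact.out : p.Prime).two_le
  -- With this `N`, one step of the induction produces degrees at most `2N`, and Λ brings them back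
  -- to `N` because `2N < p(N + 1)`.
  set N := M + p ^ d * M with hN
  have key : ∀ j, ∃ C : ℕ → MvPowerSeries σ L, (∀ i, C i ∈ degreeLE σ L N) ∧
      A 0 ^ p ^ d * (cartier p)^[j] F =
        ∑ i ∈ Finset.range (d + 1), C i * (A 0 ^ (p ^ d - p ^ i) * F ^ p ^ i) := by
    intro j
    induction j with
    | zero =>
      refine ⟨fun i => if i = 0 then A 0 else 0, fun i => ?_, ?_⟩
      · dsimp only
        split_ifs
        · exact degreeLE_mono (by lia) (hA 0)
        · exact zero_mem _
      · have : 1 ≤ p ^ d := Nat.one_le_pow _ _ (by lia)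
        obtain ⟨q, hq⟩ := Nat.exists_eq_add_of_le this
        simp only [ite_mul, zero_mul, Finset.sum_ite_eq', Finset.mem_range, Function.iterate_zero, id,
          Nat.zero_lt_succ, if_true, pow_zero, pow_one]
        rw [hq, Nat.add_sub_cancel_left]
        ring
    | succ j ih =>
      obtain ⟨C, hC, hj⟩ := ih
      -- Multiplying by `A 0 ^ (p ^ (d + 1) - p ^ d)` and eliminating `A 0 * F` by the relation
      -- removes the term `i = 0`; what remains is a sum of `p`-th powers times these `D i`.
      let D : ℕ → MvPowerSeries σ L := fun i =>
        C (i + 1) - C 0 * A (i + 1) * A 0 ^ (p ^ (i + 1) - 2)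
      have hD : ∀ i < d, D i ∈ degreeLE σ L (N + N) := by
        intro i hi
        refine sub_mem (degreeLE_mono (by lia) (hC _)) ?_
        have h1 := mul_mem_degreeLE (mul_mem_degreeLE (hC 0) (hA (i + 1)))
          (pow_mem_degreeLE (hA 0) (p ^ (i + 1) - 2))
        refine degreeLE_mono ?_ h1
        have h2 : p ^ (i + 1) - 2 ≤ p ^ d :=
          (Nat.sub_le _ _).trans (Nat.pow_le_pow_right (by lia) hi)
        have := Nat.mul_le_mul_right M h2
        lia
      have hexp : A 0 ^ p ^ (d + 1) * (cartier p)^[j] F =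
          ∑ i ∈ Finset.range d,
            (A 0 ^ (p ^ d - p ^ i) * F ^ p ^ i) ^ p * D i := by
        have hq : ∃ q, p ^ (d + 1) = p ^ d + q ∧ p ^ (d + 1) = 2 + (q + p ^ d - 2) := by
          have h1 : p ^ d ≤ p ^ (d + 1) := Nat.pow_le_pow_right (by lia) (by lia)
          have h2 : p ^ 1 ≤ p ^ (d + 1) := Nat.pow_le_pow_right (by lia) (by lia)
          exact ⟨p ^ (d + 1) - p ^ d, by lia, by lia⟩
        obtain ⟨q, hq, hq'⟩ := hq
        set w := q + p ^ d - 2 with hw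
        have h0 : A 0 * F = - ∑ i ∈ Finset.range d, A (i + 1) * F ^ p ^ (i + 1) := by
          rw [Finset.sum_range_succ'] at hF
          rw [eq_neg_iff_add_eq_zero, add_comm]
          simpa using hF
        have hpow : ∀ i ≤ d, p ^ i ≤ p ^ d := fun i hi => Nat.pow_le_pow_right (by lia) hi
        calc A 0 ^ p ^ (d + 1) * (cartier p)^[j] F
            = A 0 ^ q * (A 0 ^ p ^ d * (cartier p)^[j] F) := by rw [hq]; ring
          _ = ∑ i ∈ Finset.range d, C (i + 1) * (A 0 ^ (q + (p ^ d - p ^ (i + 1))) * F ^ p ^ (i + 1))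
                + C 0 * A 0 ^ w * (A 0 * F) := by
            rw [hj, Finset.sum_range_succ', mul_add, Finset.mul_sum]
            congr 1
            · refine Finset.sum_congr rfl fun i _ => ?_
              rw [pow_add]; ring
            · have : q + (p ^ d - p ^ 0) = w + 1 := by
                have := hpow 0 (by lia)
                have h3 : 2 ≤ p ^ (d + 1) := by lia
                rw [pow_zero] at *
                lia
              calc _ = C 0 * A 0 ^ (q + (p ^ d - p ^ 0)) * F := by rw [pow_add]; ring
                _ = _ := by rw [this]; ring
          _ = _ := by
            rw [h0, mul_neg, Finset.mul_sum, ← sub_eq_add_neg, ← Finset.sum_sub_distrib]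
            refine Finset.sum_congr rfl fun i hi => ?_
            have hi : i + 1 ≤ d := Finset.mem_range.mp hi
            have e1 : (p ^ d - p ^ i) * p = q + (p ^ d - p ^ (i + 1)) := by
              have := hpow _ hi
              rw [Nat.sub_mul, ← pow_succ, ← pow_succ]
              lia
            have e2 : w = (q + (p ^ d - p ^ (i + 1))) + (p ^ (i + 1) - 2) := by
              have := hpow _ hi
              have : p ^ 1 ≤ p ^ (i + 1) := Nat.pow_le_pow_right (by lia) (by lia)
              lia
            rw [mul_pow, ← pow_mul, ← pow_mul, e1, ← pow_succ, e2, pow_add]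
            simp only [D]
            ring
      refine ⟨fun i => if i < d then cartier p (D i) else 0, fun i => ?_, ?_⟩
      · dsimp only
        split_ifs with hi
        · refine cartier_mem_degreeLE p ?_ (hD i hi)
          have := Nat.mul_le_mul_right (N + 1) hp2
          lia
        · exact zero_mem _
      · rw [Function.iterate_succ_apply', ← cartier_pow_mul, ← pow_mul, ← pow_succ, hexp, map_sum,
          Finset.sum_range_succ]
        simp only [lt_irrefl, if_false, zero_mul, add_zero]
        refine Finset.sum_congr rfl fun i hi => ?_
        rw [if_pos (Finset.mem_range.mp hi), cartier_pow_mul, mul_comm]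
  refine ⟨(Finset.range (d + 1)).sup fun i => (degreeLE σ L N).map
    (LinearMap.mulRight L (A 0 ^ (p ^ d - p ^ i) * F ^ p ^ i)), ?_, fun j => ?_⟩
  · exact Submodule.finite_finset_sup _ _
  · obtain ⟨C, hC, hj⟩ := key j
    rw [hj]
    refine Submodule.sum_mem _ fun i hi => ?_
    refine Finset.le_sup (f := fun i => (degreeLE σ L N).map
      (LinearMap.mulRight L (A 0 ^ (p ^ d - p ^ i) * F ^ p ^ i))) hi ?_
    exact ⟨C i, hC i, rfl⟩

end Cartier

end MvPowerSeries

/-! ### Dependence of Cartier iterates and the coefficient recurrence -/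

namespace MvPowerSeries

section Relation

variable {σ L : Type*} [Finite σ] [Field L] (p : ℕ) [Fact p.Prime] [CharP L p] [PerfectRing L p]

/-- The trapping argument applies to `f ^ p ^ s`, and `s` Cartier steps turn that power back into
`f`. The common factor `A 0 ^ p ^ d` cancels in the domain of power series. -/
theorem exists_finsupp_sum_smul_cartier_iterate_eq_zero_of_relation {d s M : ℕ}
    {A : ℕ → MvPowerSeries σ L} (hA : ∀ i, A i ∈ degreeLE σ L M) (hA0 : A 0 ≠ 0)
    {f : MvPowerSeries σ L}
    (hf : ∑ i ∈ Finset.range (d + 1), A i * f ^ p ^ (s + i) = 0) :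
    ∃ c : ℕ →₀ L, c ≠ 0 ∧ (c.sum fun i a => a • (cartier p)^[i] f) = 0 := by
  obtain ⟨W, hW, hmem⟩ := exists_finite_forall_mul_cartier_iterate_mem p (d := d) hA
    (F := f ^ p ^ s) (by simpa only [← pow_mul, ← pow_add] using hf)
  have hmem' : ∀ i, A 0 ^ p ^ d * (cartier p)^[i] f ∈ W := fun i => by
    have := hmem (i + s)
    rwa [Function.iterate_add_apply, cartier_iterate_pow] at this
  have hdep : ¬ LinearIndependent L fun i : ℕ => (⟨_, hmem' i⟩ : W) := fun h =>
    not_finite_iff_infinite.mpr inferInstance h.finite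
  rw [linearIndependent_iff] at hdep
  push Not at hdep
  obtain ⟨c, hc, hc0⟩ := hdep
  refine ⟨c, hc0, ?_⟩
  have h := congrArg W.subtype hc
  rw [map_zero, Finsupp.linearCombination_apply, Finsupp.sum, map_sum] at h
  refine (mul_eq_zero_iff_left (pow_ne_zero (p ^ d) hA0)).mp ?_
  rw [Finsupp.sum, Finset.mul_sum, ← h]
  exact Finset.sum_congr rfl fun i _ => mul_smul_comm _ _ _

end Relation

/-- The iterates of the Cartier operator on an algebraic power series, computed over a perfect
extension of the field of coefficients, are linearly dependent. -/
theorem IsAlgebraicOverRatFunc.exists_finsupp_sum_smul_cartier_iterate_eq_zero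
    {σ K : Type*} (L : Type*) [Finite σ] [Field K] [Field L] [Algebra K L] (p : ℕ) [Fact p.Prime]
    [CharP L p] [PerfectRing L p] {f : MvPowerSeries σ K} (hf : f.IsAlgebraicOverRatFunc) :
    ∃ c : ℕ →₀ L, c ≠ 0 ∧
      (c.sum fun i a => a • (cartier p)^[i] (map (algebraMap K L) f)) = 0 := by
  obtain ⟨c, hc0, hc⟩ := hf.exists_finsupp_sum_coe_mul_pow_eq_zero (p ^ ·)
  have hex : ∃ s, c s ≠ 0 := by
    by_contra! h
    exact hc0 (Finsupp.ext h)
  classical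
  -- Starting at the least index with a nonzero coefficient makes the leading `A 0` nonzero.
  set s := Nat.find hex
  have hs : c s ≠ 0 := Nat.find_spec hex
  have hlt : ∀ i < s, c i = 0 := fun i hi => not_not.mp (Nat.find_min hex hi)
  set d := c.support.sup id
  have hsd : s ≤ d := Finset.le_sup (f := id) (Finsupp.mem_support_iff.mpr hs)
  have hsub : c.support ⊆ Finset.range (s + (d - s + 1)) := fun i hi => by
    have : i ≤ d := Finset.le_sup (f := id) hi
    rw [Finset.mem_range]
    lia
  refine exists_finsupp_sum_smul_cartier_iterate_eq_zero_of_relation p (d := d - s) (s := s)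
    (M := c.support.sup fun i => (c i).totalDegree)
    (A := fun i => map (algebraMap K L) (c (s + i) : MvPowerSeries σ K)) (fun i => ?_) ?_ ?_
  · by_cases h : c (s + i) = 0
    · simp only [h, MvPolynomial.coe_zero, map_zero]
      exact zero_mem _
    · intro k hk
      rw [coeff_map, coe_mem_degreeLE (c (s + i)) k, map_zero]
      exact (Finset.le_sup (f := fun i => (c i).totalDegree)
        (Finsupp.mem_support_iff.mpr h)).trans_lt hk
  · obtain ⟨k, hk⟩ := MvPolynomial.ne_zero_iff.mp hs
    intro h
    have h := congrArg (coeff k) h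
    rw [add_zero, coeff_map, MvPolynomial.coeff_coe, map_zero,
      FaithfulSMul.algebraMap_eq_zero_iff] at h
    exact hk h
  · rw [Finsupp.sum_of_support_subset _ hsub _ (by simp), Finset.sum_range_add,
      Finset.sum_eq_zero (fun i hi => by simp [hlt i (Finset.mem_range.mp hi)]), zero_add] at hc
    simpa using congrArg (map (algebraMap K L)) hc

/-- The coefficients of an algebraic power series along the powers of `p` satisfy a nontrivial
recurrence that is linear over Frobenius twists. -/
theorem IsAlgebraicOverRatFunc.exists_sum_mul_coeff_pow_eq_zero
    {σ K : Type*} [Finite σ] [Field K] (p : ℕ) [Fact p.Prime] [CharP K p]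
    {f : MvPowerSeries σ K} (hf : f.IsAlgebraicOverRatFunc) (n : σ →₀ ℕ) :
    ∃ (m : ℕ) (e : ℕ → K), (∃ i ≤ m, e i ≠ 0) ∧ ∀ j,
      ∑ i ∈ Finset.range (m + 1), e i * coeff (p ^ (i + j) • n) f ^ p ^ (m - i) = 0 := by
  let L := AlgebraicClosure K
  have : CharP L p := charP_of_injective_algebraMap (algebraMap K L).injective p
  obtain ⟨c, hc0, hc⟩ := hf.exists_finsupp_sum_smul_cartier_iterate_eq_zero L p
  obtain ⟨i₀, hi₀⟩ : ∃ i, c i ≠ 0 := by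
    by_contra! h
    exact hc0 (Finsupp.ext h)
  set m := c.support.sup id
  have hle : ∀ i ∈ c.support, i ≤ m := fun i hi => Finset.le_sup (f := id) hi
  have hsub : c.support ⊆ Finset.range (m + 1) := fun i hi =>
    Finset.mem_range.mpr (Nat.lt_succ_of_le (hle i hi))
  rw [Finsupp.sum_of_support_subset _ hsub _ (by simp)] at hc
  have hL : ∀ j, ∑ i ∈ Finset.range (m + 1), c i ^ p ^ m *
      algebraMap K L (coeff (p ^ (i + j) • n) f ^ p ^ (m - i)) = 0 := by
    intro j
    -- Since `m` bounds every index in the support, the power `p ^ m` clears all the roots taken by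
    -- Λ^i.
    have h2 := congrArg (fun u => coeff (p ^ j • n) u ^ p ^ m) hc
    simp only [map_sum, map_smul, smul_eq_mul, map_zero] at h2
    rw [sum_pow_char_pow, zero_pow (pow_ne_zero _ (NeZero.ne p))] at h2
    rw [← h2]
    refine Finset.sum_congr rfl fun i hi => ?_
    have hi : i ≤ m := Nat.lt_succ_iff.mp (Finset.mem_range.mp hi)
    obtain ⟨q, hq⟩ := Nat.exists_eq_add_of_le hi
    rw [hq, Nat.add_sub_cancel_left, mul_pow, pow_add, pow_mul (coeff _ _),
      coeff_cartier_iterate_pow, coeff_map, smul_smul, ← pow_add p i j, map_pow]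
  -- Only the multipliers `c i ^ p ^ m` lie outside `K`; a `K`-linear functional nonzero on one of
  -- them keeps the recurrence nontrivial.
  obtain ⟨φ, hφ⟩ := Module.Projective.exists_dual_ne_zero K (pow_ne_zero (p ^ m) hi₀)
  refine ⟨m, fun i => φ (c i ^ p ^ m), ⟨i₀, hle i₀ (Finsupp.mem_support_iff.mpr hi₀), hφ⟩,
    fun j => ?_⟩
  have h := congrArg φ (hL j)
  rw [map_zero, map_sum] at h
  rw [← h]
  refine Finset.sum_congr rfl fun i _ => ?_
  rw [mul_comm (c i ^ p ^ m), ← Algebra.smul_def, map_smul, smul_eq_mul, mul_comm]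

end MvPowerSeries

/-! ### Algebraicity of lacunary series -/

namespace PowerSeries

variable {K : Type*} [Field K] (p : ℕ)

open Classical in
/-- The series `∑ b_k X^{p^k}`. -/
noncomputable def lacunary (b : ℕ → K) : PowerSeries K :=
  mk fun l => if p ^ Nat.log p l = l then b (Nat.log p l) else 0

theorem coeff_lacunary_of_ne (b : ℕ → K) {l : ℕ} (h : ∀ k, p ^ k ≠ l) :
    coeff l (lacunary p b) = 0 := by
  simp [lacunary, h]

variable [Fact p.Prime]

theorem coeff_pow_lacunary (b : ℕ → K) (k : ℕ) : coeff (p ^ k) (lacunary p b) = b k := by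
  have : Nat.log p (p ^ k) = k := Nat.log_pow (Fact.out : p.Prime).one_lt k
  simp [lacunary, this]

theorem lacunary_pow_char [CharP K p] (b : ℕ → K) :
    lacunary p b ^ p = lacunary p fun k => if k = 0 then 0 else b (k - 1) ^ p := by
  have hp : p ≠ 0 := NeZero.ne p
  have h1 : lacunary p b ^ p = PowerSeries.map (frobenius K p) (expand p hp (lacunary p b)) :=
    (MvPowerSeries.map_frobenius_expand (σ := Unit) p hp).symm
  ext l
  rw [h1, coeff_map]
  by_cases hl : ∃ k, p ^ k = l
  · obtain ⟨k, rfl⟩ := hl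
    rw [coeff_pow_lacunary]
    cases k with
    | zero => simp [coeff_expand_of_not_dvd p hp _ (Fact.out : p.Prime).not_dvd_one]
    | succ k => rw [pow_succ', coeff_expand_mul, coeff_pow_lacunary]; simp [frobenius_def]
  · push Not at hl
    rw [coeff_lacunary_of_ne p _ hl]
    by_cases hd : p ∣ l
    · obtain ⟨q, rfl⟩ := hd
      rw [coeff_expand_mul, coeff_lacunary_of_ne, map_zero]
      exact fun k hk => hl (k + 1) (by rw [pow_succ', hk])
    · rw [coeff_expand_of_not_dvd p hp _ hd, map_zero]

theorem lacunary_pow_char_pow [CharP K p] (b : ℕ → K) (q : ℕ) :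
    lacunary p b ^ p ^ q = lacunary p fun k => if k < q then 0 else b (k - q) ^ p ^ q := by
  induction q with
  | zero => simp
  | succ q ih =>
    rw [pow_succ, pow_mul, ih, lacunary_pow_char]
    congr 1
    funext k
    rcases k with _ | k
    · simp
    · by_cases h : k < q
      · simp [h, NeZero.ne p]
      · simp [h, pow_mul]

/-- For `k ≥ m` the coefficient at `X^{p^k}` is the recurrence at `j = k - m`, hence zero;
truncation below `p ^ m` loses nothing. -/
theorem sum_smul_lacunary_pow [CharP K p] (b : ℕ → K) {m : ℕ} {e : ℕ → K}
    (h : ∀ j, ∑ i ∈ Finset.range (m + 1), e i * b (i + j) ^ p ^ (m - i) = 0) :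
    ∑ i ∈ Finset.range (m + 1), C (e i) * lacunary p b ^ p ^ (m - i) ∈
      Set.range ((↑) : Polynomial K → PowerSeries K) := by
  refine ⟨trunc (p ^ m) (∑ i ∈ Finset.range (m + 1), C (e i) * lacunary p b ^ p ^ (m - i)), ?_⟩
  ext l
  rw [Polynomial.coeff_coe, coeff_trunc]
  split_ifs with hl
  · rfl
  rw [map_sum]
  simp only [coeff_C_mul, lacunary_pow_char_pow]
  by_cases hk : ∃ k, p ^ k = l
  · obtain ⟨k, rfl⟩ := hk
    have hk : m ≤ k := by
      by_contra! hk
      exact hl (Nat.pow_lt_pow_right (Fact.out : p.Prime).one_lt hk)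
    rw [← h (k - m)]
    refine Finset.sum_congr rfl fun i hi => ?_
    rw [coeff_pow_lacunary, if_neg (by lia)]
    have := Finset.mem_range.mp hi
    congr 3
    lia
  · push Not at hk
    exact (Finset.sum_eq_zero fun i _ => by rw [coeff_lacunary_of_ne p _ hk, mul_zero]).symm

open scoped RatFunc in
theorem isAlgebraicOverRatFunc_lacunary [CharP K p] (b : ℕ → K) {m : ℕ} {e : ℕ → K}
    (he : ∃ i ≤ m, e i ≠ 0)
    (h : ∀ j, ∑ i ∈ Finset.range (m + 1), e i * b (i + j) ^ p ^ (m - i) = 0) :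
    (lacunary p b).IsAlgebraicOverRatFunc := by
  obtain ⟨Q, hQ⟩ := sum_smul_lacunary_pow p b h
  have hp : p.Prime := Fact.out
  have hK : IsAlgebraic (Polynomial K) (lacunary p b) := by
    refine ⟨∑ i ∈ Finset.range (m + 1), Polynomial.monomial (p ^ (m - i)) (Polynomial.C (e i))
      - Polynomial.C Q, fun h0 => ?_, ?_⟩
    · obtain ⟨i, him, hi⟩ := he
      -- The exponents `p ^ (m - i)` are distinct and positive, so neither the other terms nor `Q`
      -- can cancel `e i`.
      have hc := congrArg (fun P => Polynomial.coeff P (p ^ (m - i))) h0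
      simp only [Polynomial.coeff_sub, Polynomial.finsetSum_coeff, Polynomial.coeff_monomial,
        Polynomial.coeff_zero, Polynomial.coeff_C_of_ne_zero (pow_ne_zero _ hp.ne_zero),
        sub_zero] at hc
      rw [Finset.sum_eq_single i, if_pos rfl] at hc
      · exact hi (Polynomial.C_eq_zero.mp hc)
      · intro k hk hki
        rw [if_neg]
        intro hpow
        have := Nat.pow_right_injective hp.two_le hpow
        have := Finset.mem_range.mp hk
        lia
      · intro h
        exact absurd (Finset.mem_range.mpr (by lia)) h
    · rw [map_sub, map_sum, Polynomial.aeval_C, sub_eq_zero]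
      refine Eq.trans ?_ (hQ.symm.trans ?_)
      · refine Finset.sum_congr rfl fun i _ => ?_
        rw [Polynomial.aeval_monomial]
        simp [algebraMap_apply']
      · simp [algebraMap_apply']
  have : FaithfulSMul (PowerSeries K) (LaurentSeries K) :=
    (faithfulSMul_iff_algebraMap_injective _ _).mpr (IsFractionRing.injective _ _)
  have : IsScalarTower (Polynomial K) (PowerSeries K) (LaurentSeries K) :=
    IsScalarTower.of_algebraMap_eq fun P => by
      simp [Polynomial.algebraMap_hahnSeries_apply, PowerSeries.algebraMap_apply']
  have h2 : IsAlgebraic (Polynomial K)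
      (algebraMap (PowerSeries K) (LaurentSeries K) (lacunary p b)) := hK.algebraMap
  exact (IsFractionRing.isAlgebraic_iff (Polynomial K) (RatFunc K) (LaurentSeries K)).mp h2

end PowerSeries

theorem mainTheorem8 {K : Type*} [Field K] (p : ℕ) [CharP K p] (hp : 0 < p) (r : ℕ)
    (f : MvPowerSeries (Fin r) K) (hf : MvPowerSeries.IsAlgebraicOverRatFunc f)
    (n : Fin r →₀ ℕ) (hn : n ≠ 0) :
    PowerSeries.IsAlgebraicOverRatFunc (frobeniusRaySeries p f n) := by
  have : NeZero p := ⟨hp.ne'⟩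
  have : Fact p.Prime := CharP.char_is_prime_of_pos K p
  obtain ⟨m, e, he, h⟩ := hf.exists_sum_mul_coeff_pow_eq_zero p n
  have heq : frobeniusRaySeries p f n =
      PowerSeries.lacunary p fun k => MvPowerSeries.coeff (p ^ k • n) f := by
    ext l
    by_cases hl : ∃ k, p ^ k = l
    · obtain ⟨k, rfl⟩ := hl
      rw [coeff_pow_frobeniusRaySeries, PowerSeries.coeff_pow_lacunary]
    · push Not at hl
      rw [coeff_frobeniusRaySeries_of_ne p f n l fun k => (hl k).symm,
        PowerSeries.coeff_lacunary_of_ne p _ hl]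
  rw [heq]
  exact PowerSeries.isAlgebraicOverRatFunc_lacunary p _ he h
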